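/- For complex numbers $a,b,c,d,e$ consider the sequence $(T(n))_{n\ge 0}$ determined by $T(0)=1$ and the four-term recurrence $$(n+1)^3T(n+1)=(2n+1)(an^2+an+b)\,T(n)+n(cn^2+d)\,T(n-1)+e\,n(n-1)(2n-1)\,T(n-2)\qquad(n\ge 0);$$ the single initial condition suffices, because the coefficient of $T(n-1)$ vanishes at $n=0$ and the coefficient of $T(n-2)$ vanishes at $n=0$ and $n=1$. Let $T_{15A},T_{15B},T_{15C},T_{15\overline{C}}$ be the sequences obtained for \begin{align*} T_{15A}:&\quad (a,b,c,d,e)=(7,\,3,\,-29,\,-4,\,30),\\ T_{15B}:&\quad (a,b,c,d,e)=(-17,\,-9,\,-389,\,-76,\,-750),\\ T_{15C}:&\quad (a,b,c,d,e)=(5+4i,\,2+2i,\,31-60i,\,5-8i,\,-40-30i),\\ T_{15\overline{C}}:&\quad (a,b,c,d,e)=(5-4i,\,2-2i,\,31+60i,\,5+8i,\,-40+30i). \end{align*} **Theorem.** For all complex $w$ in a neighborhood of $w=0$ the following four series converge absolutely and \begin{align*} \sum_{n=0}^\infty T_{15A}(n)\left(\frac{w}{1+w-w^2}\right)^{n+1}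 &=\sum_{n=0}^\infty T_{15B}(n)\left(\frac{w}{1-11w-w^2}\right)^{n+1}\\ &=\sum_{n=0}^\infty T_{15C}(n)\left(\frac{w}{1+2iw-w^2}\right)^{n+1}\\ &=\sum_{n=0}^\infty T_{15\overline{C}}(n)\left(\frac{w}{1-2iw-w^2}\right)^{n+1}. \end{align*} -/

import Mathlib

/-- The sequence determined by `T 0 = 1` and the four-term recurrence
`(n+1)^3 T(n+1) = (2n+1)(a n^2 + a n + b) T(n) + n (c n^2 + d) T(n-1) + e n (n-1) (2n-1) T(n-2)`,
solved for the leading term. The coefficient of `T(n-1)` vanishes for `n = 0`, and that of `T(n-2)`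
for `n = 0` and `n = 1`, so the terms with negative index do not occur and the first two steps are
listed separately. -/
noncomputable def fourTermSeq (a b c d e : ℂ) : ℕ → ℂ
  | 0 => 1
  | 1 => b
  | 2 => (3 * (2 * a + b) * fourTermSeq a b c d e 1 + (c + d) * fourTermSeq a b c d e 0) / 8
  | (n + 3) =>
      ((2 * ((n : ℂ) + 2) + 1) * (a * ((n : ℂ) + 2) ^ 2 + a * ((n : ℂ) + 2) + b)
            * fourTermSeq a b c d e (n + 2)
          + ((n : ℂ) + 2) * (c * ((n : ℂ) + 2) ^ 2 + d) * fourTermSeq a b c d e (n + 1)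
          + e * ((n : ℂ) + 2) * (2 * ((n : ℂ) + 2) - 1) * (((n : ℂ) + 2) - 1)
            * fourTermSeq a b c d e n)
        / ((n : ℂ) + 3) ^ 3

theorem fourTermSeq_zero (a b c d e : ℂ) : fourTermSeq a b c d e 0 = 1 := by
  simp [fourTermSeq]

/-- The four-term recurrence, for every `n ≥ 0`. The truncated subtractions `n - 1` and `n - 2` in
the indices are harmless, since they are truncated only where the coefficient is zero. -/
theorem fourTermSeq_rec (a b c d e : ℂ) (n : ℕ) :
    ((n : ℂ) + 1) ^ 3 * fourTermSeq a b c d e (n + 1) =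
      (2 * (n : ℂ) + 1) * (a * (n : ℂ) ^ 2 + a * (n : ℂ) + b) * fourTermSeq a b c d e n
        + (n : ℂ) * (c * (n : ℂ) ^ 2 + d) * fourTermSeq a b c d e (n - 1)
        + e * (n : ℂ) * (2 * (n : ℂ) - 1) * ((n : ℂ) - 1) * fourTermSeq a b c d e (n - 2) := by
  match n with
  | 0 => simp [fourTermSeq]
  | 1 => simp [fourTermSeq]; ring
  | (m + 2) =>
    have h : ((m : ℂ) + 3) ≠ 0 := by exact_mod_cast (Nat.succ_ne_zero (m + 2))
    have h1 : m + 2 - 1 = m + 1 := rfl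
    have h2 : m + 2 - 2 = m := rfl
    have h3 : m + 2 + 1 = m + 3 := rfl
    rw [h1, h2, h3, fourTermSeq]
    push_cast
    rw [show (m : ℂ) + 2 + 1 = (m : ℂ) + 3 by ring, mul_div_cancel₀ _ (pow_ne_zero 3 h)]

/-- `T_{15A}`, the case `ε = 1`. -/
noncomputable def T15A : ℕ → ℂ := fourTermSeq 7 3 (-29) (-4) 30

/-- `T_{15B}`, the case `ε = -11`. -/
noncomputable def T15B : ℕ → ℂ := fourTermSeq (-17) (-9) (-389) (-76) (-750)

/-- `T_{15C}`, the case `ε = 2i`. -/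
noncomputable def T15C : ℕ → ℂ :=
  fourTermSeq (5 + 4 * Complex.I) (2 + 2 * Complex.I) (31 - 60 * Complex.I) (5 - 8 * Complex.I)
    (-40 - 30 * Complex.I)

/-- `T_{15C̄}`, the case `ε = -2i`. -/
noncomputable def T15Cbar : ℕ → ℂ :=
  fourTermSeq (5 - 4 * Complex.I) (2 - 2 * Complex.I) (31 + 60 * Complex.I) (5 + 8 * Complex.I)
    (-40 + 30 * Complex.I)

/-- The `n`-th term of `∑ T(n) (w / (1 + ε w - w²))^(n+1)`. -/
noncomputable def genTerm (T : ℕ → ℂ) (ε w : ℂ) (n : ℕ) : ℂ :=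
  T n * (w / (1 + ε * w - w ^ 2)) ^ (n + 1)

/-! The functional `X ^ n ↦ T n` turns the recurrence for `T` into the vanishing of the functional
on the image of a third-order differential operator `recOp`, with leading coefficient `P = X^4 -
2aX^3 - cX^2 - 2eX`. If `-δ` is a root of `P`, the operator acts on the powers of `X + δ` by a
recurrence of the same shape. Hence the binomial transform of `T` is again a four-term sequence
(`fourTermSeq_binomial`). On generating functions this transform is `1/x ↦ 1/x - δ`
(`hasSum_binomial_transform`). With `1/x = 1/w + ε - w` it only shifts `ε`. The nonzero roots of `P`
for 15A give the other three sequences. -/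

/-! ### Umbral calculus for the recurrence. -/

open Polynomial in
/-- The linear functional on polynomials sending `X ^ n` to `T n`. -/
noncomputable def umbral (T : ℕ → ℂ) : ℂ[X] →ₗ[ℂ] ℂ :=
  Polynomial.lsum fun n => (T n) • LinearMap.id

open Polynomial in
theorem umbral_X_pow (T : ℕ → ℂ) (n : ℕ) : umbral T (X ^ n) = T n := by
  simp [umbral, Polynomial.lsum_apply, ← Polynomial.monomial_one_right_eq_X_pow]

open Polynomial in
theorem umbral_C_mul (T : ℕ → ℂ) (z : ℂ) (p : ℂ[X]) : umbral T (C z * p) = z * umbral T p := by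
  rw [← Polynomial.smul_eq_C_mul, map_smul, smul_eq_mul]

open Polynomial in
/-- The differential operator adjoint to the four-term recurrence. -/
noncomputable def recOp (a b c d e : ℂ) : ℂ[X] →ₗ[ℂ] ℂ[X] :=
  LinearMap.mulLeft ℂ (X ^ 4 - C (2 * a) * X ^ 3 - C c * X ^ 2 - C (2 * e) * X) ∘ₗ
      derivative ∘ₗ derivative ∘ₗ derivative
    + LinearMap.mulLeft ℂ (C 6 * X ^ 3 - C (9 * a) * X ^ 2 - C (3 * c) * X - C (3 * e)) ∘ₗ
      derivative ∘ₗ derivative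
    + LinearMap.mulLeft ℂ (C 7 * X ^ 2 - C (6 * a + 2 * b) * X - C (c + d)) ∘ₗ derivative
    + LinearMap.mulLeft ℂ (X - C b)

open Polynomial in
-- Expanding the coefficients in powers of `X + δ` could leave a fifth term, in `(X + δ) ^ (n - 3)`;
-- its coefficient is a multiple of `P(-δ)`, which `h` makes zero.
theorem recOp_X_add_C_pow {a b c d e a' b' c' d' e' δ : ℂ} (ha : a' = a + 2 * δ)
    (hb : b' = b + δ) (hc : c' = c - 6 * δ ^ 2 - 6 * a * δ) (hd : d' = d - δ ^ 2 - 2 * b * δ)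
    (he : e' = e + 2 * δ ^ 3 + 3 * a * δ ^ 2 - c * δ)
    (h : δ * (δ ^ 3 + 2 * a * δ ^ 2 - c * δ + 2 * e) = 0) (n : ℕ) :
    recOp a b c d e ((X + C δ) ^ n) =
      C (((n : ℂ) + 1) ^ 3) * (X + C δ) ^ (n + 1)
        - C ((2 * (n : ℂ) + 1) * (a' * (n : ℂ) ^ 2 + a' * (n : ℂ) + b')) * (X + C δ) ^ n
        - C ((n : ℂ) * (c' * (n : ℂ) ^ 2 + d')) * (X + C δ) ^ (n - 1)
        - C (e' * (n : ℂ) * (2 * (n : ℂ) - 1) * ((n : ℂ) - 1)) * (X + C δ) ^ (n - 2) := by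
  have hX : (X : ℂ[X]) = (X + C δ) - C δ := by ring
  have hC := congrArg (C : ℂ → ℂ[X]) h
  subst ha hb hc hd he
  simp only [recOp, LinearMap.add_apply, LinearMap.comp_apply, LinearMap.mulLeft_apply]
  match n with
  | 0 => simp
  | 1 =>
    simp [C_ofNat]
    ring
  | 2 =>
    simp only [derivative_X_add_C_pow, derivative_C_mul]
    simp [C_ofNat]
    ring
  | m + 3 =>
    simp only [derivative_X_add_C_pow, derivative_C_mul,
      show m + 3 - 1 = m + 2 from rfl, show m + 2 - 1 = m + 1 from rfl,
      show m + 1 - 1 = m from rfl, show m + 3 - 2 = m + 1 from rfl]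
    generalize hV : (X : ℂ[X]) + C δ = V at *
    rw [hX]
    simp only [map_mul, map_add, map_sub, map_pow, map_one, map_zero, map_natCast, C_ofNat,
      Nat.cast_add, Nat.cast_ofNat, Nat.cast_one] at hC ⊢
    -- The multiplier of `hC` is the third derivative of `V ^ (m + 3)`.
    linear_combination ((m : ℂ[X]) + 1) * (m + 2) * (m + 3) * V ^ m * hC

theorem umbral_recOp (a b c d e : ℂ) (p : Polynomial ℂ) :
    umbral (fourTermSeq a b c d e) (recOp a b c d e p) = 0 := by
  suffices H : umbral (fourTermSeq a b c d e) ∘ₗ recOp a b c d e = 0 from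
    LinearMap.congr_fun H p
  refine Polynomial.lhom_ext' fun n => LinearMap.ext_ring ?_
  -- The shift by `0` gives the action on the monomials.
  have h := recOp_X_add_C_pow (a := a) (b := b) (c := c) (d := d) (e := e) (δ := 0)
    (a' := a) (b' := b) (c' := c) (d' := d) (e' := e)
    (by ring) (by ring) (by ring) (by ring) (by ring) (by ring) n
  rw [Polynomial.C_0, add_zero] at h
  simp only [LinearMap.comp_apply, Polynomial.monomial_one_right_eq_X_pow, h, map_sub,
    umbral_C_mul, umbral_X_pow, LinearMap.zero_apply]
  linear_combination fourTermSeq_rec a b c d e n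

theorem eq_fourTermSeq {a b c d e : ℂ} {S : ℕ → ℂ} (h0 : S 0 = 1)
    (h : ∀ n : ℕ, ((n : ℂ) + 1) ^ 3 * S (n + 1) =
      (2 * (n : ℂ) + 1) * (a * (n : ℂ) ^ 2 + a * (n : ℂ) + b) * S n
        + (n : ℂ) * (c * (n : ℂ) ^ 2 + d) * S (n - 1)
        + e * (n : ℂ) * (2 * (n : ℂ) - 1) * ((n : ℂ) - 1) * S (n - 2)) (n : ℕ) :
    S n = fourTermSeq a b c d e n := by
  induction n using Nat.strong_induction_on with
  | _ n ih =>
    match n with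
    | 0 => rw [h0, fourTermSeq_zero]
    | m + 1 =>
      have hm : ((m : ℂ) + 1) ^ 3 ≠ 0 := pow_ne_zero 3 (Nat.cast_add_one_ne_zero m)
      apply mul_left_cancel₀ hm
      rw [h, fourTermSeq_rec, ih m (by omega), ih (m - 1) (by omega), ih (m - 2) (by omega)]

/-- Shifting the variable of the umbral functional turns one four-term sequence into another. -/
theorem fourTermSeq_binomial {a b c d e a' b' c' d' e' δ : ℂ} (ha : a' = a + 2 * δ)
    (hb : b' = b + δ) (hc : c' = c - 6 * δ ^ 2 - 6 * a * δ) (hd : d' = d - δ ^ 2 - 2 * b * δ)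
    (he : e' = e + 2 * δ ^ 3 + 3 * a * δ ^ 2 - c * δ)
    (h : δ * (δ ^ 3 + 2 * a * δ ^ 2 - c * δ + 2 * e) = 0) (n : ℕ) :
    fourTermSeq a' b' c' d' e' n =
      ∑ p ∈ Finset.HasAntidiagonal.antidiagonal n, fourTermSeq a b c d e p.1 * (n.choose p.1 : ℂ) * δ ^ p.2 := by
  have key : umbral (fourTermSeq a b c d e) ((Polynomial.X + Polynomial.C δ) ^ n) =
      fourTermSeq a' b' c' d' e' n := by
    refine eq_fourTermSeq (S := fun n => umbral (fourTermSeq a b c d e)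
      ((Polynomial.X + Polynomial.C δ) ^ n)) ?_ (fun n => ?_) n
    · simpa [fourTermSeq_zero] using umbral_X_pow (fourTermSeq a b c d e) 0
    · have H := umbral_recOp a b c d e ((Polynomial.X + Polynomial.C δ) ^ n)
      rw [recOp_X_add_C_pow ha hb hc hd he h] at H
      simp only [map_sub, umbral_C_mul] at H
      linear_combination H
  rw [← key, (Commute.all _ _).add_pow', map_sum]
  refine Finset.sum_congr rfl fun p _ => ?_
  rw [map_nsmul, ← Polynomial.C_pow, mul_comm (Polynomial.X ^ p.1), umbral_C_mul, umbral_X_pow,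
    nsmul_eq_mul]
  ring

/-! ### Growth and generating functions. -/

theorem exists_norm_fourTermSeq_le (a b c d e : ℂ) :
    ∃ K : ℝ, 1 ≤ K ∧ ∀ n, ‖fourTermSeq a b c d e n‖ ≤ K ^ n := by
  -- `K - 1` bounds the sum of the norms of the three coefficients divided by `(m + 1) ^ 3`; the
  -- summand `1` makes `K ^ n` monotone in `n`.
  set K : ℝ := 1 + (4 * ‖a‖ + 2 * ‖b‖ + ‖c‖ + ‖d‖ + 2 * ‖e‖) with hK
  have h1 : 1 ≤ K := by
    rw [hK]
    linarith [norm_nonneg a, norm_nonneg b, norm_nonneg c, norm_nonneg d, norm_nonneg e]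
  refine ⟨K, h1, fun n => ?_⟩
  induction n using Nat.strong_induction_on with
  | _ n ih =>
    match n with
    | 0 => simp [fourTermSeq_zero]
    | m + 1 =>
      have hb1 := ih m (by omega)
      have hb2 := (ih (m - 1) (by omega)).trans (pow_le_pow_right₀ h1 (Nat.sub_le m 1))
      have hb3 := (ih (m - 2) (by omega)).trans (pow_le_pow_right₀ h1 (Nat.sub_le m 2))
      have hrec := congrArg norm (fourTermSeq_rec a b c d e m)
      have hm : (0 : ℝ) ≤ m := Nat.cast_nonneg m
      have hn1 : ‖(m : ℂ) + 1‖ = (m : ℝ) + 1 := by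
        rw [← Nat.cast_add_one, Complex.norm_natCast, Nat.cast_add_one]
      have hn0 : ‖(m : ℂ)‖ = (m : ℝ) := Complex.norm_natCast m
      have c1 : ‖(2 * (m : ℂ) + 1) * (a * (m : ℂ) ^ 2 + a * (m : ℂ) + b)‖ ≤
          ((m : ℝ) + 1) ^ 3 * (4 * ‖a‖ + 2 * ‖b‖) := by
        have e1 : ‖2 * (m : ℂ) + 1‖ ≤ 2 * (m + 1) := by
          refine (norm_add_le _ _).trans ?_
          rw [norm_mul, hn0]; norm_num; linarith
        have e2 : ‖a * (m : ℂ) ^ 2 + a * (m : ℂ) + b‖ ≤ (m + 1) ^ 2 * (2 * ‖a‖ + ‖b‖) := by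
          refine (norm_add₃_le).trans ?_
          rw [norm_mul, norm_mul, norm_pow, hn0]
          have := mul_nonneg hm (norm_nonneg a)
          have := mul_nonneg hm (norm_nonneg b)
          have := mul_nonneg (mul_nonneg hm hm) (norm_nonneg a)
          have := mul_nonneg (mul_nonneg hm hm) (norm_nonneg b)
          nlinarith [norm_nonneg a]
        rw [norm_mul]
        refine (mul_le_mul e1 e2 (norm_nonneg _) (by positivity)).trans (le_of_eq (by ring))
      have c2 : ‖(m : ℂ) * (c * (m : ℂ) ^ 2 + d)‖ ≤ ((m : ℝ) + 1) ^ 3 * (‖c‖ + ‖d‖) := by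
        have e2 : ‖c * (m : ℂ) ^ 2 + d‖ ≤ (m + 1) ^ 2 * (‖c‖ + ‖d‖) := by
          refine (norm_add_le _ _).trans ?_
          rw [norm_mul, norm_pow, hn0]
          have := mul_nonneg hm (norm_nonneg c)
          have := mul_nonneg hm (norm_nonneg d)
          have := mul_nonneg (mul_nonneg hm hm) (norm_nonneg d)
          nlinarith [norm_nonneg c]
        rw [norm_mul, hn0]
        refine (mul_le_mul (by linarith : (m : ℝ) ≤ m + 1) e2 (norm_nonneg _)
          (by positivity)).trans (le_of_eq (by ring))
      have c3 : ‖e * (m : ℂ) * (2 * (m : ℂ) - 1) * ((m : ℂ) - 1)‖ ≤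
          ((m : ℝ) + 1) ^ 3 * (2 * ‖e‖) := by
        have e1 : ‖2 * (m : ℂ) - 1‖ ≤ 2 * (m + 1) := by
          refine (norm_sub_le _ _).trans ?_
          rw [norm_mul, hn0]; norm_num; linarith
        have e2 : ‖(m : ℂ) - 1‖ ≤ m + 1 := by
          refine (norm_sub_le _ _).trans ?_
          rw [hn0, norm_one]
        rw [norm_mul, norm_mul, norm_mul, hn0]
        calc ‖e‖ * (m : ℝ) * ‖2 * (m : ℂ) - 1‖ * ‖(m : ℂ) - 1‖
            ≤ ‖e‖ * (m + 1) * (2 * (m + 1)) * (m + 1) := by gcongr; linarith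
          _ = _ := by ring
      have hpos : (0 : ℝ) < ((m : ℝ) + 1) ^ 3 := by positivity
      rw [norm_mul, norm_pow, hn1] at hrec
      refine le_of_mul_le_mul_left ?_ hpos
      rw [hrec]
      refine (norm_add₃_le).trans ?_
      rw [norm_mul _ (fourTermSeq a b c d e m), norm_mul _ (fourTermSeq a b c d e (m - 1)),
        norm_mul _ (fourTermSeq a b c d e (m - 2))]
      have hKm : (0 : ℝ) ≤ K ^ m := by positivity
      calc _ ≤ ((m : ℝ) + 1) ^ 3 * (4 * ‖a‖ + 2 * ‖b‖) * K ^ m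
            + ((m : ℝ) + 1) ^ 3 * (‖c‖ + ‖d‖) * K ^ m
            + ((m : ℝ) + 1) ^ 3 * (2 * ‖e‖) * K ^ m := by gcongr
        _ = ((m : ℝ) + 1) ^ 3 * ((K - 1) * K ^ m) := by rw [hK]; ring
        _ ≤ ((m : ℝ) + 1) ^ 3 * K ^ (m + 1) := by
          rw [pow_succ' K m]
          exact mul_le_mul_of_nonneg_left
            (mul_le_mul_of_nonneg_right (sub_le_self K zero_le_one) hKm) hpos.le

/-- The generating function of a binomial transform, for small arguments. -/
theorem hasSum_binomial_transform {T S : ℕ → ℂ} {δ x : ℂ} {K : ℝ} (hK : 1 ≤ K)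
    (hT : ∀ n, ‖T n‖ ≤ K ^ n)
    (hS : ∀ n, S n = ∑ p ∈ Finset.HasAntidiagonal.antidiagonal n, T p.1 * (n.choose p.1 : ℂ) * δ ^ p.2)
    (hx : (K + ‖δ‖) * ‖x‖ < 1) :
    Summable (fun n => T n * (x / (1 - δ * x)) ^ (n + 1)) ∧
      HasSum (fun n => S n * x ^ (n + 1)) (∑' n, T n * (x / (1 - δ * x)) ^ (n + 1)) := by
  have hx0 := norm_nonneg x
  have hKx : 0 ≤ K * ‖x‖ := by positivity
  have hδx : 0 ≤ ‖δ‖ * ‖x‖ := by positivity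
  have hδ1 : ‖δ * x‖ < 1 := by rw [norm_mul]; linarith
  have h1δ : (0 : ℝ) < 1 - ‖δ‖ * ‖x‖ := by linarith
  -- Rows of `f` sum to the `T` side by the negative binomial series, antidiagonals to the `S` side;
  -- absolute summability allows the exchange.
  let f : ℕ × ℕ → ℂ := fun p =>
    T p.1 * ((p.1 + p.2).choose p.1 : ℂ) * δ ^ p.2 * x ^ (p.1 + p.2 + 1)
  have hrow : ∀ k, HasSum (fun j => f (k, j)) (T k * (x / (1 - δ * x)) ^ (k + 1)) := fun k => by
    have := (hasSum_choose_mul_geometric_of_norm_lt_one k hδ1).mul_left (T k * x ^ (k + 1))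
    convert! this using 1
    · funext j
      simp only [f]
      rw [add_comm k j]
      ring
    · rw [div_pow]; ring
  have hrown : ∀ k, HasSum (fun j => ‖f (k, j)‖)
      (‖T k‖ * ‖x‖ ^ (k + 1) * (1 / (1 - ‖δ‖ * ‖x‖) ^ (k + 1))) := fun k => by
    have := (hasSum_choose_mul_geometric_of_norm_lt_one (𝕜 := ℝ) (r := ‖δ‖ * ‖x‖) k
      (by rw [Real.norm_of_nonneg hδx]; linarith)).mul_left (‖T k‖ * ‖x‖ ^ (k + 1))
    convert! this using 1
    funext j
    simp only [f, norm_mul, norm_pow, Complex.norm_natCast]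
    rw [add_comm k j]
    ring
  have hq : K * ‖x‖ / (1 - ‖δ‖ * ‖x‖) < 1 := by rw [div_lt_one h1δ]; linarith
  have hf : Summable f := by
    refine Summable.of_norm ?_
    rw [summable_prod_of_nonneg (fun _ => norm_nonneg _)]
    refine ⟨fun k => (hrown k).summable, ?_⟩
    simp only [(hrown _).tsum_eq]
    refine Summable.of_nonneg_of_le (fun k => by positivity) (fun k => ?_)
      ((summable_geometric_of_lt_one (by positivity) hq).mul_left
        (‖x‖ / (1 - ‖δ‖ * ‖x‖)))
    calc ‖T k‖ * ‖x‖ ^ (k + 1) * (1 / (1 - ‖δ‖ * ‖x‖) ^ (k + 1))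
        ≤ K ^ k * ‖x‖ ^ (k + 1) * (1 / (1 - ‖δ‖ * ‖x‖) ^ (k + 1)) := by gcongr; exact hT k
      _ = _ := by rw [div_pow, mul_pow, pow_succ, pow_succ]; field_simp
  have hsum := hf.hasSum.prod_fiberwise hrow
  refine ⟨hsum.summable, ?_⟩
  rw [hsum.tsum_eq]
  convert (Finset.HasAntidiagonal.sigmaAntidiagonalEquivProd.hasSum_iff.mpr hf.hasSum).sigma
    (fun n => hasSum_fintype _) using 1
  funext n
  rw [hS, Finset.sum_mul]
  refine Eq.trans ?_ (Finset.sum_coe_sort (Finset.HasAntidiagonal.antidiagonal n) f).symm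
  refine Finset.sum_congr rfl fun p hp => ?_
  rw [Finset.HasAntidiagonal.mem_antidiagonal] at hp
  simp only [f, hp]

/-- Two four-term sequences related by a shift have the same generating function in `w`. -/
theorem genTerm_eventually {a b c d e a' b' c' d' e' δ ε ε' : ℂ} (hε : ε' = ε + δ)
    (ha : a' = a + 2 * δ) (hb : b' = b + δ) (hc : c' = c - 6 * δ ^ 2 - 6 * a * δ) (hd : d' = d - δ ^ 2 - 2 * b * δ)
    (he : e' = e + 2 * δ ^ 3 + 3 * a * δ ^ 2 - c * δ)
    (h : δ * (δ ^ 3 + 2 * a * δ ^ 2 - c * δ + 2 * e) = 0) :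
    ∀ᶠ w : ℂ in nhds 0, Summable (genTerm (fourTermSeq a b c d e) ε w) ∧
      Summable (genTerm (fourTermSeq a' b' c' d' e') ε' w) ∧
      ∑' n, genTerm (fourTermSeq a b c d e) ε w n =
        ∑' n, genTerm (fourTermSeq a' b' c' d' e') ε' w n := by
  obtain ⟨K, hK, hT⟩ := exists_norm_fourTermSeq_le a b c d e
  have hne : ∀ᶠ w : ℂ in nhds 0, 1 + ε' * w - w ^ 2 ≠ 0 := by
    have hc : ContinuousAt (fun w : ℂ => 1 + ε' * w - w ^ 2) 0 := by fun_prop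
    exact hc.eventually_ne (by simp)
  have hlt : ∀ᶠ w : ℂ in nhds 0, (K + ‖δ‖) * ‖w / (1 + ε' * w - w ^ 2)‖ < 1 := by
    have hc : ContinuousAt (fun w : ℂ => (K + ‖δ‖) * ‖w / (1 + ε' * w - w ^ 2)‖) 0 := by
      refine continuousAt_const.mul (ContinuousAt.norm ?_)
      exact continuousAt_id.div (by fun_prop) (by simp)
    exact hc.eventually_lt continuousAt_const (by simp)
  filter_upwards [hne, hlt] with w hw hx
  obtain ⟨h1, h2⟩ := hasSum_binomial_transform hK hT
    (fourTermSeq_binomial ha hb hc hd he h) hx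
  -- For `w ≠ 0` this is `(1/w + ε' - w) - δ = 1/w + ε - w` on reciprocals.
  have hx' : w / (1 + ε' * w - w ^ 2) / (1 - δ * (w / (1 + ε' * w - w ^ 2))) =
      w / (1 + ε * w - w ^ 2) := by
    have : 1 - δ * (w / (1 + ε' * w - w ^ 2)) =
        (1 + ε * w - w ^ 2) / (1 + ε' * w - w ^ 2) := by
      rw [eq_div_iff hw, sub_mul, mul_assoc, div_mul_cancel₀ _ hw, hε]
      ring
    rw [this, div_div_div_cancel_right₀ hw]
  rw [hx'] at h1 h2
  exact ⟨h1, h2.summable, h2.tsum_eq.symm⟩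

/-! ### The four sequences, each compared with 15A. -/

theorem mainTheorem7 :
    ∀ᶠ w : ℂ in nhds 0,
      (Summable (genTerm T15A 1 w) ∧ Summable (genTerm T15B (-11) w) ∧
        Summable (genTerm T15C (2 * Complex.I) w) ∧
        Summable (genTerm T15Cbar (-2 * Complex.I) w)) ∧
      ∑' n, genTerm T15A 1 w n = ∑' n, genTerm T15B (-11) w n ∧
      ∑' n, genTerm T15B (-11) w n = ∑' n, genTerm T15C (2 * Complex.I) w n ∧
      ∑' n, genTerm T15C (2 * Complex.I) w n =
        ∑' n, genTerm T15Cbar (-2 * Complex.I) w n := by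
  have hI2 : Complex.I ^ 2 = -1 := Complex.I_sq
  have hI3 : Complex.I ^ 3 = -Complex.I := Complex.I_pow_three
  have hI4 : Complex.I ^ 4 = 1 := Complex.I_pow_four
  -- For 15A, `P = X (X - 12) (X^2 - 2X + 5)`, so `-δ` is `12` or `1 ± 2i`.
  have hB := genTerm_eventually (a := 7) (b := 3) (c := -29) (d := -4) (e := 30)
    (a' := -17) (b' := -9) (c' := -389) (d' := -76) (e' := -750) (δ := -12) (ε := 1) (ε' := -11)
    (by norm_num) (by norm_num) (by norm_num) (by norm_num) (by norm_num) (by norm_num)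
    (by norm_num)
  have hC := genTerm_eventually (a := 7) (b := 3) (c := -29) (d := -4) (e := 30)
    (a' := 5 + 4 * Complex.I) (b' := 2 + 2 * Complex.I) (c' := 31 - 60 * Complex.I)
    (d' := 5 - 8 * Complex.I) (e' := -40 - 30 * Complex.I) (δ := 2 * Complex.I - 1) (ε := 1)
    (ε' := 2 * Complex.I)
    (by ring) (by ring) (by ring) (by ring_nf; simp only [hI2]; ring)
    (by ring_nf; simp only [hI2]; ring) (by ring_nf; simp only [hI2, hI3]; ring)
    (by ring_nf; simp only [hI2, hI3, hI4]; ring)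
  have hD := genTerm_eventually (a := 7) (b := 3) (c := -29) (d := -4) (e := 30)
    (a' := 5 - 4 * Complex.I) (b' := 2 - 2 * Complex.I) (c' := 31 + 60 * Complex.I)
    (d' := 5 + 8 * Complex.I) (e' := -40 + 30 * Complex.I) (δ := -2 * Complex.I - 1) (ε := 1)
    (ε' := -2 * Complex.I)
    (by ring) (by ring) (by ring) (by ring_nf; simp only [hI2]; ring)
    (by ring_nf; simp only [hI2]; ring) (by ring_nf; simp only [hI2, hI3]; ring)
    (by ring_nf; simp only [hI2, hI3, hI4]; ring)
  filter_upwards [hB, hC, hD] with w hB hC hD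
  exact ⟨⟨hB.1, hB.2.1, hC.2.1, hD.2.1⟩, hB.2.2, hB.2.2.symm.trans hC.2.2,
    hC.2.2.symm.trans hD.2.2⟩
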